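/- Let $F$ be a probability distribution on $[0,\infty)$ which either has a density with respect to Lebesgue measure or is a lattice distribution, i.e. is concentrated on a set $b+a\mathbb{Z}$ with $b\in\mathbb{R}$, $a>0$. For a jointly measurable real-valued process $(Y_t)_{t\in\mathbb{R}}$ on a probability space write $\overline{Y}_F:=\int_{[0,\infty)}Y_t\,dF(t)$. Then the identity $$\mathbb{E}\bigl(Y_0 \mid \overline{Y}_F\bigr)=\overline{Y}_F\quad\text{almost surely}$$ holds for every jointly measurable (strictly) stationary process $(Y_t)_{t\in\mathbb{R}}$ with $\mathbb{E}|Y_0|<\infty$ if and only if either $F$ has density $\lambda e^{-\lambda t}$, $t\ge 0$, for some $\lambda\in(0,\infty)$, or $F=\delta_0$. -/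

import Mathlib

open MeasureTheory ProbabilityTheory

/-- A real process `Y` indexed by `ℝ` is (strictly) stationary under `P`: for every shift `h`, all
finite-dimensional distributions of `(Y (t + h))` and `(Y t)` agree. -/
def IsStationaryProcess {Ω : Type*} [MeasurableSpace Ω] (Y : ℝ → Ω → ℝ) (P : Measure Ω) : Prop :=
  ∀ (h : ℝ) (n : ℕ) (t : Fin n → ℝ),
    P.map (fun ω i => Y (t i + h) ω) = P.map (fun ω i => Y (t i) ω)

/-- `F` has a density with respect to Lebesgue measure. -/
def HasLebesgueDensity (F : Measure ℝ) : Prop :=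
  ∃ f : ℝ → ENNReal, Measurable f ∧ F = volume.withDensity f

/-- `F` is a lattice distribution: it is concentrated on `b + aℤ` for some `b` and some `a > 0`. -/
def IsLatticeDistribution (F : Measure ℝ) : Prop :=
  ∃ b a : ℝ, 0 < a ∧ ∀ᵐ x ∂F, ∃ k : ℤ, x = b + k * a

/-- The weighted average `∫ Y_t dF(t)` of a process; it is used for `F` concentrated
on `[0, ∞)`, with a possible atom of `F` at `0` included. -/
noncomputable def weightedAverage {Ω : Type*} (F : Measure ℝ) (Y : ℝ → Ω → ℝ) (ω : Ω) : ℝ :=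
  ∫ t in Set.Ici 0, Y t ω ∂F

/-- The identity `E(Y_0 | Ȳ) = Ȳ` a.s., with `Ȳ` the weighted average of `Y` with respect to `F`;
the conditioning is on the `σ`-field generated by the real random variable `Ȳ`. -/
def ConditioningIdentity {Ω : Type*} [MeasurableSpace Ω] (F : Measure ℝ) (Y : ℝ → Ω → ℝ)
    (P : Measure Ω) : Prop :=
  P[Y 0 | MeasurableSpace.comap (weightedAverage F Y) inferInstance] =ᵐ[P] weightedAverage F Y

/-- For a jointly measurable process the conditioning `σ`-field is a sub-`σ`-field of the ambient
one, so that the conditional expectation above is the genuine one. -/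
theorem comap_weightedAverage_le {Ω : Type*} [m : MeasurableSpace Ω] (F : Measure ℝ)
    [IsProbabilityMeasure F] (Y : ℝ → Ω → ℝ) (hY : Measurable (Function.uncurry Y)) :
    MeasurableSpace.comap (weightedAverage F Y) inferInstance ≤ m := by
  have h : StronglyMeasurable (fun ω => ∫ t, Y t ω ∂(F.restrict (Set.Ici 0))) :=
    StronglyMeasurable.integral_prod_right (f := fun ω t => Y t ω)
      (hY.comp measurable_swap).stronglyMeasurable
  exact h.measurable.comap_le

/- Necessity: for frequencies `x + y + z = 0`, test the identity on the stationary process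
`Re (u e^{ixτ} + v e^{iyτ} + c e^{izτ} (uv)⁻¹)` with `(u, v)` uniform on the torus. Averaging with
respect to `F` multiplies the three amplitudes by the values of the characteristic function `φ`,
and only the resonance of the three frequencies survives in `𝔼 Y₀ Ȳ² = 𝔼 Ȳ³`. This forces
`1 / φ(x) + 1 / φ(y) + 1 / φ(z) = 3`, so `1 / φ - 1` is additive, hence linear:
`1 / φ(s) = 1 - ics`.

Sufficiency: for the exponential law of rate `r` the moving average `Z s = ∫ Y (t + s) dF(t)` solves
`Z' = r (Z - Y)`. The pair `(Z s, Y s)` has the same law for every `s`, because `Z s` is an almost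
sure limit of means of `Y (· + s)` over independent random times. So `𝔼 G(Z s)` is constant, and
`𝔼 G'(Z 0) (Z 0 - Y 0) = 0` for every primitive `G` of a test function. -/

open Filter Topology UnitAddTorus
open scoped ComplexConjugate Real NNReal

section ConditionalExpectation

variable {Ω : Type*} [mΩ : MeasurableSpace Ω] {P : Measure Ω}

theorem integral_mul_condExp {m : MeasurableSpace Ω} (hm : m ≤ mΩ) [SigmaFinite (P.trim hm)]
    {h X : Ω → ℝ} (hh : StronglyMeasurable[m] h) {C : ℝ} (hC : ∀ ω, ‖h ω‖ ≤ C)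
    (hX : Integrable X P) : ∫ ω, h ω * P[X | m] ω ∂P = ∫ ω, h ω * X ω ∂P := by
  have hhX : Integrable (h * X) P :=
    hX.bdd_mul (hh.mono hm).aestronglyMeasurable (.of_forall hC)
  rw [← integral_condExp hm (f := fun ω => h ω * X ω)]
  exact integral_congr_ae (condExp_mul_of_stronglyMeasurable_left hh hhX hX).symm

theorem ConditioningIdentity.integral_comp_mul [IsFiniteMeasure P] {F : Measure ℝ}
    [IsProbabilityMeasure F] {Y : ℝ → Ω → ℝ} (hid : ConditioningIdentity F Y P)
    (hY : Measurable (Function.uncurry Y)) (hint : Integrable (Y 0) P) {g : ℝ → ℝ}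
    (hg : Measurable g) {C : ℝ} (hC : ∀ ω, ‖g (weightedAverage F Y ω)‖ ≤ C) :
    ∫ ω, g (weightedAverage F Y ω) * Y 0 ω ∂P =
      ∫ ω, g (weightedAverage F Y ω) * weightedAverage F Y ω ∂P := by
  refine (integral_mul_condExp (comap_weightedAverage_le F Y hY)
    (hg.comp (comap_measurable _)).stronglyMeasurable hC hint).symm.trans ?_
  refine integral_congr_ae ?_
  filter_upwards [hid] with ω hω
  rw [hω, Function.comp_apply]

theorem condExp_comap_ae_eq_zero [IsFiniteMeasure P] {Z D : Ω → ℝ} (hZ : Measurable Z)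
    (hD : Integrable D P)
    (h : ∀ g : ℝ → ℝ, Continuous g → HasCompactSupport g → ∫ ω, g (Z ω) * D ω ∂P = 0) :
    P[D | MeasurableSpace.comap Z inferInstance] =ᵐ[P] 0 := by
  obtain ⟨f, hf, hfZ⟩ :=
    (stronglyMeasurable_condExp (m := MeasurableSpace.comap Z inferInstance)
      (μ := P) (f := D)).measurable.exists_eq_measurable_comp
  have hfint : Integrable f (P.map Z) := by
    rw [integrable_map_measure hf.aestronglyMeasurable hZ.aemeasurable, ← hfZ]
    exact integrable_condExp
  have hf0 : ∀ᵐ x ∂(P.map Z), f x = 0 := by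
    refine ae_eq_zero_of_integral_contDiff_smul_eq_zero hfint.locallyIntegrable fun g hg hgs => ?_
    obtain ⟨C, hC⟩ := hg.continuous.bounded_above_of_compact_support hgs
    have hgm : StronglyMeasurable[MeasurableSpace.comap Z inferInstance] (g ∘ Z) :=
      (hg.continuous.measurable.comp (comap_measurable Z)).stronglyMeasurable
    have hgf : Measurable fun x => g x • f x := hg.continuous.measurable.smul hf
    rw [integral_map hZ.aemeasurable hgf.aestronglyMeasurable, ← h g hg.continuous hgs]
    simpa only [hfZ, Function.comp_apply, smul_eq_mul] using
      integral_mul_condExp hZ.comap_le hgm (fun ω => hC (Z ω)) hD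
  rw [hfZ]
  exact ae_of_ae_map hZ.aemeasurable hf0

end ConditionalExpectation

theorem weightedAverage_eq_integral {Ω : Type*} {F : Measure ℝ} (hF : ∀ᵐ t ∂F, 0 ≤ t)
    (Y : ℝ → Ω → ℝ) : weightedAverage F Y = fun ω => ∫ t, Y t ω ∂F := by
  funext ω
  rw [weightedAverage, Measure.restrict_eq_self_of_ae_mem (s := Set.Ici 0) hF]

section Torus

variable {d ι : Type*}

/-- The point at time `τ` of the linear flow on the torus with angular velocities `ξ`, started
at `0`. -/
noncomputable def torusFlow (ξ : d → ℝ) (τ : ℝ) : UnitAddTorus d :=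
  fun j => ((ξ j * τ / (2 * π) : ℝ) : UnitAddCircle)

theorem torusFlow_zero (ξ : d → ℝ) : torusFlow ξ 0 = 0 := by
  ext j
  simp [torusFlow]

theorem torusFlow_add (ξ : d → ℝ) (s t : ℝ) :
    torusFlow ξ (s + t) = torusFlow ξ s + torusFlow ξ t := by
  ext j
  simp only [torusFlow, Pi.add_apply, ← AddCircle.coe_add, mul_add, add_div]

theorem continuous_torusFlow (ξ : d → ℝ) : Continuous (torusFlow ξ) :=
  continuous_pi fun j => (AddCircle.continuous_mk' 1).comp (by fun_prop)

variable [Fintype d] [Fintype ι]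

instance : IsProbabilityMeasure (volume : Measure UnitAddCircle) :=
  ⟨UnitAddCircle.measure_univ⟩

theorem mFourier_apply_add (k : d → ℤ) (x y : UnitAddTorus d) :
    mFourier k (x + y) = mFourier k x * mFourier k y := by
  simp only [mFourier, ContinuousMap.coe_mk, Pi.add_apply, fourier_apply, smul_add,
    AddCircle.toCircle_add, Circle.coe_mul, Finset.prod_mul_distrib]

theorem exists_mFourier_eq_neg_one {k : d → ℤ} (hk : k ≠ 0) :
    ∃ y : UnitAddTorus d, mFourier k y = -1 := by
  classical
  obtain ⟨i, hi⟩ := Function.ne_iff.mp hk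
  refine ⟨Pi.single i ((1 / 2 / k i : ℝ) : UnitAddCircle), ?_⟩
  simp only [mFourier, ContinuousMap.coe_mk]
  rw [Finset.prod_eq_single i (fun j _ hj => by rw [Pi.single_eq_of_ne hj, fourier_eval_zero])
    (fun h => absurd (Finset.mem_univ i) h), Pi.single_eq_same, ← fourier_eval_zero (k i),
    ← fourier_add_half_inv_index hi one_pos, zero_add]

open Classical in
theorem integral_mFourier (k : d → ℤ) :
    ∫ x : UnitAddTorus d, mFourier k x = if k = 0 then 1 else 0 := by
  split_ifs with hk
  · simp [hk, mFourier_zero]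
  · obtain ⟨y, hy⟩ := exists_mFourier_eq_neg_one hk
    refine integral_eq_zero_of_add_right_eq_neg (g := y) fun x => ?_
    rw [mFourier_apply_add, hy, mul_neg_one]

theorem mFourier_torusFlow (k : d → ℤ) (ξ : d → ℝ) (τ : ℝ) :
    mFourier k (torusFlow ξ τ) = Complex.exp (((∑ j, k j * ξ j : ℝ) : ℂ) * τ * Complex.I) := by
  simp only [mFourier, ContinuousMap.coe_mk, torusFlow]
  simp_rw [fourier_coe_apply]
  rw [← Complex.exp_sum]
  congr 1
  push_cast
  rw [Finset.sum_mul, Finset.sum_mul]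
  refine Finset.sum_congr rfl fun j _ => ?_
  field_simp

/-- The real trigonometric polynomial on the torus with frequencies `k i` and complex
amplitudes `a i`. -/
noncomputable def realTrigPolynomial (k : ι → d → ℤ) (a : ι → ℂ) (x : UnitAddTorus d) : ℝ :=
  ∑ i, (a i * mFourier (k i) x).re

theorem continuous_realTrigPolynomial (k : ι → d → ℤ) (a : ι → ℂ) :
    Continuous (realTrigPolynomial k a) := by
  unfold realTrigPolynomial
  fun_prop

theorem integral_realTrigPolynomial_torusFlow_add (F : Measure ℝ) [IsProbabilityMeasure F]
    (k : ι → d → ℤ) (a : ι → ℂ) (ξ : d → ℝ) (x : UnitAddTorus d) :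
    ∫ τ, realTrigPolynomial k a (torusFlow ξ τ + x) ∂F =
      realTrigPolynomial k (fun i => a i * charFun F (∑ j, k i j * ξ j)) x := by
  have hterm : ∀ i τ, a i * mFourier (k i) (torusFlow ξ τ + x) = a i * mFourier (k i) x *
      Complex.exp (((∑ j, k i j * ξ j : ℝ) : ℂ) * τ * Complex.I) := fun i τ => by
    rw [mFourier_apply_add, mFourier_torusFlow]
    ring
  have hint : ∀ i, Integrable (fun τ : ℝ => a i * mFourier (k i) x *
      Complex.exp (((∑ j, k i j * ξ j : ℝ) : ℂ) * τ * Complex.I)) F := fun i => by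
    refine Integrable.const_mul (Integrable.of_bound (by fun_prop) 1 (.of_forall fun τ => ?_)) _
    rw [← Complex.ofReal_mul, Complex.norm_exp_ofReal_mul_I]
  simp only [realTrigPolynomial, hterm]
  rw [integral_finsetSum _ fun i _ => by exact (hint i).re]
  refine Finset.sum_congr rfl fun i _ => ?_
  refine (integral_re (hint i)).trans ?_
  rw [integral_const_mul, charFun_apply_real, mul_right_comm]
  rfl

open Classical in
theorem integral_re_mul_re_mul_re (k l m : d → ℤ) (a b c : ℂ) :
    ∫ x, (a * mFourier k x).re * (b * mFourier l x).re * (c * mFourier m x).re =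
      4⁻¹ * ((if k + l + m = 0 then a * b * c else 0) +
        (if k + l - m = 0 then a * b * conj c else 0) +
        (if k - l + m = 0 then a * conj b * c else 0) +
        (if k - l - m = 0 then a * conj b * conj c else 0)).re := by
  have hchar : ∀ (z : ℂ) (n : d → ℤ), Integrable fun x => z * mFourier n x := fun z n =>
    (continuous_const.mul (map_continuous _)).integrable_of_hasCompactSupport
      (HasCompactSupport.of_compactSpace _)
  have hpoint : ∀ x, (a * mFourier k x).re * (b * mFourier l x).re * (c * mFourier m x).re =
      4⁻¹ * (a * b * c * mFourier (k + l + m) x + a * b * conj c * mFourier (k + l - m) x +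
        a * conj b * c * mFourier (k - l + m) x +
        a * conj b * conj c * mFourier (k - l - m) x).re := fun x => by
    simp only [sub_eq_add_neg, mFourier_add, mFourier_neg, Complex.add_re, Complex.mul_re,
      Complex.mul_im, Complex.conj_re, Complex.conj_im]
    ring
  have hint : ∫ x, (a * b * c * mFourier (k + l + m) x + a * b * conj c * mFourier (k + l - m) x +
        a * conj b * c * mFourier (k - l + m) x +
        a * conj b * conj c * mFourier (k - l - m) x) = (if k + l + m = 0 then a * b * c else 0) +
        (if k + l - m = 0 then a * b * conj c else 0) +
        (if k - l + m = 0 then a * conj b * c else 0) +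
        (if k - l - m = 0 then a * conj b * conj c else 0) := by
    rw [integral_add (by fun_prop) (hchar _ _), integral_add (by fun_prop) (hchar _ _),
      integral_add (hchar _ _) (hchar _ _)]
    simp only [integral_const_mul, integral_mFourier, mul_ite, mul_one, mul_zero]
  simp only [hpoint]
  rw [integral_const_mul]
  congr 1
  rw [← hint]
  exact integral_re ((((hchar _ _).add (hchar _ _)).add (hchar _ _)).add (hchar _ _))

end Torus

section Resonance

/-- Three frequencies on the two-dimensional torus whose only additive relation of length three is
that their sum vanishes. The index type is lifted so that the torus lives in any given universe. -/
def resonantTriad (i : Fin 3) (j : ULift (Fin 2)) : ℤ :=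
  ![![1, 0], ![0, 1], ![-1, -1]] i j.down

theorem resonantTriad_add_add_eq_zero_iff (i j l : Fin 3) :
    resonantTriad i + resonantTriad j + resonantTriad l = 0 ↔ i ≠ j ∧ j ≠ l ∧ i ≠ l := by
  simp only [funext_iff, ULift.forall, Fin.forall_fin_two, Pi.add_apply, Pi.zero_apply,
    resonantTriad]
  revert i j l
  decide

theorem resonantTriad_add_ne (i j l : Fin 3) :
    resonantTriad i + resonantTriad j ≠ resonantTriad l := by
  simp only [ne_eq, funext_iff, ULift.forall, Fin.forall_fin_two, Pi.add_apply, resonantTriad]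
  revert i j l
  decide

theorem integral_re_mul_re_mul_re_resonantTriad (i j l : Fin 3) (a b c : ℂ) :
    ∫ x, (a * mFourier (resonantTriad i) x).re * (b * mFourier (resonantTriad j) x).re *
        (c * mFourier (resonantTriad l) x).re =
      if i ≠ j ∧ j ≠ l ∧ i ≠ l then 4⁻¹ * (a * b * c).re else 0 := by
  rw [integral_re_mul_re_mul_re, sub_add_eq_add_sub, sub_sub]
  simp only [sub_eq_zero, resonantTriad_add_add_eq_zero_iff, resonantTriad_add_ne,
    (resonantTriad_add_ne _ _ _).symm, if_false, add_zero]
  split_ifs <;> simp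

theorem integral_realTrigPolynomial_resonantTriad_mul_sq.{u} (a p : Fin 3 → ℂ) :
    ∫ x, realTrigPolynomial resonantTriad.{u} a x * realTrigPolynomial resonantTriad p x ^ 2 =
      2⁻¹ * (a 0 * p 1 * p 2 + p 0 * a 1 * p 2 + p 0 * p 1 * a 2).re := by
  have hint : ∀ i j l : Fin 3, Integrable fun x => (a i * mFourier (resonantTriad.{u} i) x).re *
      (p j * mFourier (resonantTriad j) x).re * (p l * mFourier (resonantTriad l) x).re :=
    fun i j l => Continuous.integrable_of_hasCompactSupport (by fun_prop)
      (HasCompactSupport.of_compactSpace _)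
  have hexpand : ∀ x, realTrigPolynomial resonantTriad.{u} a x *
      realTrigPolynomial resonantTriad p x ^ 2 =
      ∑ i, ∑ j, ∑ l, (a i * mFourier (resonantTriad i) x).re *
      (p j * mFourier (resonantTriad j) x).re * (p l * mFourier (resonantTriad l) x).re :=
    fun x => by
      simp only [realTrigPolynomial, Fin.sum_univ_three]
      ring
  simp only [hexpand]
  rw [integral_finsetSum _ fun i _ => integrable_finsetSum _ fun j _ =>
    integrable_finsetSum _ fun l _ => hint i j l]
  simp_rw [integral_finsetSum _ fun j _ => integrable_finsetSum _ fun l _ => hint _ j l,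
    integral_finsetSum _ fun l _ => hint _ _ l, integral_re_mul_re_mul_re_resonantTriad]
  simp [Fin.sum_univ_three]
  ring

end Resonance

theorem IsStationaryProcess.of_measurePreserving {Ω : Type*} [MeasurableSpace Ω]
    {P : Measure Ω} {Y : ℝ → Ω → ℝ} (hY : ∀ t, Measurable (Y t)) (T : ℝ → Ω → Ω)
    (hT : ∀ h, MeasurePreserving (T h) P P) (hYT : ∀ t h, Y (t + h) = Y t ∘ T h) :
    IsStationaryProcess Y P := by
  intro h n t
  have hcomp : (fun ω (i : Fin n) => Y (t i + h) ω) = (fun ω i => Y (t i) ω) ∘ T h := by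
    simp only [hYT]
    rfl
  rw [hcomp, ← Measure.map_map (measurable_pi_lambda _ fun i => hY (t i)) (hT h).measurable,
    (hT h).map_eq]

section CubicRelation

/-- The conditioning identity for the law `F` and all stationary processes on probability spaces in
a fixed universe. -/
def ConditioningIdentityForAll.{u} (F : Measure ℝ) : Prop :=
  ∀ (Ω : Type u) [MeasurableSpace Ω] (P : Measure Ω) [IsProbabilityMeasure P] (Y : ℝ → Ω → ℝ),
    Measurable (Function.uncurry Y) → IsStationaryProcess Y P → Integrable (Y 0) P →
      ConditioningIdentity F Y P

theorem ConditioningIdentityForAll.integral_realTrigPolynomial_mul_sq.{u} {F : Measure ℝ}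
    [IsProbabilityMeasure F] (hF : ∀ᵐ t ∂F, 0 ≤ t) (h : ConditioningIdentityForAll.{u} F)
    {d : Type u} {ι : Type*} [Fintype d] [Fintype ι] (k : ι → d → ℤ) (a : ι → ℂ) (ξ : d → ℝ) :
    let p : ι → ℂ := fun i => a i * charFun F (∑ j, k i j * ξ j)
    ∫ x, realTrigPolynomial k a x * realTrigPolynomial k p x ^ 2 =
      ∫ x, realTrigPolynomial k p x * realTrigPolynomial k p x ^ 2 := by
  intro p
  let Y : ℝ → UnitAddTorus d → ℝ := fun τ x => realTrigPolynomial k a (torusFlow ξ τ + x)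
  have hY : Measurable (Function.uncurry Y) := ((continuous_realTrigPolynomial k a).comp
    (((continuous_torusFlow ξ).comp continuous_fst).add continuous_snd)).measurable
  have hstat : IsStationaryProcess Y volume :=
    .of_measurePreserving (fun t => hY.of_uncurry_left) (fun h x => torusFlow ξ h + x)
      (fun h => measurePreserving_add_left volume _) fun t h => by
        funext x
        simp only [Y, torusFlow_add, Function.comp_apply, add_assoc]
  have hY0 : Y 0 = realTrigPolynomial k a := by
    funext x
    simp only [Y, torusFlow_zero, zero_add]
  have hint : Integrable (Y 0) :=
    hY0 ▸ (continuous_realTrigPolynomial k a).integrable_of_hasCompactSupport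
      (HasCompactSupport.of_compactSpace _)
  have havg : weightedAverage F Y = realTrigPolynomial k p := by
    rw [weightedAverage_eq_integral hF]
    funext x
    exact integral_realTrigPolynomial_torusFlow_add F k a ξ x
  obtain ⟨C, hC⟩ := isCompact_univ.exists_bound_of_continuousOn
    ((continuous_realTrigPolynomial k p).pow 2).continuousOn
  have key := (h _ volume Y hY hstat hint).integral_comp_mul hY hint (g := fun z => z ^ 2)
    (by fun_prop) (C := C) (by simpa [havg] using hC)
  simpa only [havg, hY0, mul_comm] using key

/-- The relation `1 / φ x + 1 / φ y + 1 / φ z = 3` for `x + y + z = 0`, with denominators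
cleared. -/
def SatisfiesCubicRelation (φ : ℝ → ℂ) : Prop :=
  ∀ x y z, x + y + z = 0 → φ y * φ z + φ x * φ z + φ x * φ y = 3 * (φ x * φ y * φ z)

theorem ConditioningIdentityForAll.satisfiesCubicRelation.{u} {F : Measure ℝ}
    [IsProbabilityMeasure F] (hF : ∀ᵐ t ∂F, 0 ≤ t) (h : ConditioningIdentityForAll.{u} F) :
    SatisfiesCubicRelation (charFun F) := by
  intro x y z hxyz
  set φ := charFun F
  have hz : z = -x + -y := by linarith
  let ξ : ULift.{u} (Fin 2) → ℝ := fun j => ![x, y] j.down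
  have hfreq : ∀ i, ∑ j, resonantTriad i j * ξ j = ![x, y, z] i := fun i => by
    rw [← Equiv.ulift.symm.sum_comp]
    fin_cases i <;> simp [resonantTriad, ξ, hz]
  have hre : ∀ c : ℂ,
      (c * (φ y * φ z + φ x * φ z + φ x * φ y - 3 * (φ x * φ y * φ z))).re = 0 := fun c => by
    have key := h.integral_realTrigPolynomial_mul_sq hF resonantTriad ![1, 1, c] ξ
    simp only [hfreq, integral_realTrigPolynomial_resonantTriad_mul_sq] at key
    simp only [Matrix.cons_val] at key
    rw [← sub_eq_zero, ← mul_sub, ← Complex.sub_re] at key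
    convert (mul_eq_zero_iff_left (by norm_num)).mp key using 2
    ring
  refine sub_eq_zero.mp (Complex.ext ?_ ?_)
  · simpa only [one_mul, Complex.zero_re] using hre 1
  · simpa only [neg_mul, Complex.neg_re, Complex.I_mul_re, neg_neg, Complex.zero_im] using
      hre (-Complex.I)

end CubicRelation

section CubicRelationSolutions

variable {φ : ℝ → ℂ}

theorem SatisfiesCubicRelation.apply_half_eq_zero (h : SatisfiesCubicRelation φ) (h0 : φ 0 = 1)
    {x : ℝ} (hx : φ x = 0) : φ (x / 2) = 0 := by
  have hneg : φ (-x) = 0 := by simpa [h0, hx] using h x (-x) 0 (by ring)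
  simpa [hneg] using h (x / 2) (x / 2) (-x) (by ring)

theorem SatisfiesCubicRelation.apply_ne_zero (h : SatisfiesCubicRelation φ) (h0 : φ 0 = 1)
    (hφ : ContinuousAt φ 0) (x : ℝ) : φ x ≠ 0 := by
  intro hx
  have hzero : ∀ n : ℕ, φ (x * (1 / 2) ^ n) = 0 := fun n => by
    induction n with
    | zero => simpa using hx
    | succ n ih =>
      convert h.apply_half_eq_zero h0 ih using 2
      ring
  have hlim : Tendsto (fun n : ℕ => x * (1 / 2) ^ n) atTop (𝓝 0) := by
    simpa using (tendsto_pow_atTop_nhds_zero_of_lt_one (r := (1 / 2 : ℝ))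
      (by norm_num) (by norm_num)).const_mul x
  have hφ0 : φ 0 = 0 :=
    tendsto_nhds_unique (hφ.tendsto.comp hlim) (tendsto_const_nhds.congr fun n => (hzero n).symm)
  exact one_ne_zero (h0.symm.trans hφ0)

theorem SatisfiesCubicRelation.exists_inv_eq (h : SatisfiesCubicRelation φ) (h0 : φ 0 = 1)
    (hφ : Continuous φ) : ∃ c : ℂ, ∀ x : ℝ, (φ x)⁻¹ = 1 + x * c := by
  have hne := h.apply_ne_zero h0 hφ.continuousAt
  have hsum : ∀ x y z, x + y + z = 0 → (φ x)⁻¹ + (φ y)⁻¹ + (φ z)⁻¹ = 3 := fun x y z hxyz => by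
    have hx := hne x
    have hy := hne y
    have hz := hne z
    field_simp
    linear_combination h x y z hxyz
  have hneg : ∀ x, (φ (-x))⁻¹ = 2 - (φ x)⁻¹ := fun x => by
    have hx := hsum x (-x) 0 (by ring)
    rw [h0] at hx
    linear_combination hx
  let ψ : ℝ →+ ℂ :=
    { toFun := fun x => (φ x)⁻¹ - 1
      map_zero' := by simp [h0]
      map_add' := fun x y => by
        linear_combination hsum (-x) (-y) (x + y) (by ring) - hneg x - hneg y }
  have hψ : Continuous ψ := (hφ.inv₀ hne).sub continuous_const
  refine ⟨ψ 1, fun x => ?_⟩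
  have hlin : ψ x = x * ψ 1 := by simpa using (ψ.toRealLinearMap hψ).map_smul x (1 : ℝ)
  rw [← hlin]
  exact (add_sub_cancel _ _).symm

theorem SatisfiesCubicRelation.exists_charFun_eq {F : Measure ℝ} [IsProbabilityMeasure F]
    (h : SatisfiesCubicRelation (charFun F)) :
    ∃ c : ℝ, ∀ s : ℝ, charFun F s = (1 - c * s * Complex.I)⁻¹ := by
  obtain ⟨z, hz⟩ := h.exists_inv_eq (by simp) continuous_charFun
  have hre : z.re = 0 := by
    have hsymm : (charFun F (-1))⁻¹ = conj (charFun F 1)⁻¹ := by rw [charFun_neg, map_inv₀]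
    simp only [hz, Complex.ext_iff, Complex.conj_re, Complex.add_re, Complex.one_re,
      Complex.re_ofReal_mul] at hsymm
    linarith [hsymm.1]
  have hzI : z = z.im * Complex.I := Complex.ext (by simp [hre]) (by simp)
  refine ⟨-z.im, fun s => ?_⟩
  rw [← inv_inv (charFun F s), hz]
  congr 1
  push_cast
  linear_combination (s : ℂ) * hzI

end CubicRelationSolutions

section Exponential

theorem expMeasure_eq_withDensity_restrict (r : ℝ) :
    expMeasure r = (volume.restrict (Set.Ioi 0)).withDensity
      fun x => ENNReal.ofReal (r * Real.exp (-(r * x))) := by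
  change volume.withDensity (exponentialPDF r) = _
  rw [← withDensity_indicator measurableSet_Ioi]
  refine withDensity_congr_ae ?_
  filter_upwards [Measure.ae_ne volume 0] with x hx
  rcases lt_or_gt_of_ne hx with hx | hx
  · rw [exponentialPDF_of_neg hx, Set.indicator_of_notMem (Set.notMem_Ioi.mpr hx.le)]
  · rw [exponentialPDF_of_nonneg hx.le, Set.indicator_of_mem (Set.mem_Ioi.mpr hx)]

theorem ae_pos_expMeasure (r : ℝ) : ∀ᵐ x ∂expMeasure r, 0 < x := by
  rw [expMeasure_eq_withDensity_restrict]
  exact (withDensity_absolutelyContinuous _ _).ae_le (ae_restrict_mem measurableSet_Ioi)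

variable {E : Type*} [NormedAddCommGroup E] [NormedSpace ℝ E] {r : ℝ}

theorem integral_expMeasure (hr : 0 < r) (f : ℝ → E) :
    ∫ x, f x ∂expMeasure r = ∫ x in Set.Ioi 0, (r * Real.exp (-(r * x))) • f x := by
  rw [expMeasure_eq_withDensity_restrict,
    integral_withDensity_eq_integral_toReal_smul (by fun_prop) (by simp)]
  refine integral_congr_ae (.of_forall fun x => ?_)
  dsimp only
  rw [ENNReal.toReal_ofReal (by positivity)]

theorem integrable_expMeasure_iff (hr : 0 < r) (f : ℝ → E) :
    Integrable f (expMeasure r) ↔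
      IntegrableOn (fun x => (r * Real.exp (-(r * x))) • f x) (Set.Ioi 0) := by
  rw [expMeasure_eq_withDensity_restrict,
    integrable_withDensity_iff_integrable_smul' (by fun_prop) (by simp), IntegrableOn]
  refine integrable_congr (.of_forall fun x => ?_)
  dsimp only
  rw [ENNReal.toReal_ofReal (by positivity)]

theorem charFun_expMeasure (hr : 0 < r) (s : ℝ) :
    charFun (expMeasure r) s = (1 - (r⁻¹ : ℝ) * s * Complex.I)⁻¹ := by
  have hr0 : (r : ℂ) ≠ 0 := by exact_mod_cast hr.ne'
  set a : ℂ := -r + s * Complex.I with ha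
  have ha_re : a.re < 0 := by simpa [ha] using hr
  have hexp : ∀ x : ℝ, (r * Real.exp (-(r * x))) • Complex.exp (s * x * Complex.I) =
      r * Complex.exp (a * x) := fun x => by
    rw [Complex.real_smul]
    push_cast
    rw [mul_assoc, ← Complex.exp_add, ha]
    ring_nf
  have hfactor : 1 - (r⁻¹ : ℝ) * s * Complex.I = -a / r := by
    rw [ha]
    push_cast
    field_simp
    ring
  rw [charFun_apply_real, integral_expMeasure hr]
  simp_rw [hexp]
  rw [integral_const_mul, integral_exp_mul_complex_Ioi ha_re, hfactor]
  simp [div_eq_mul_inv]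

theorem eq_expMeasure_or_dirac_of_charFun {F : Measure ℝ} [IsProbabilityMeasure F]
    (hF : ∀ᵐ t ∂F, 0 ≤ t) {c : ℝ} (hc : ∀ s : ℝ, charFun F s = (1 - c * s * Complex.I)⁻¹) :
    (∃ r : ℝ, 0 < r ∧ F = expMeasure r) ∨ F = Measure.dirac 0 := by
  rcases lt_trichotomy c 0 with hneg | rfl | hpos
  · have hr : 0 < (-c)⁻¹ := by simpa using hneg
    have := isProbabilityMeasure_expMeasure hr
    have hmap : F.map (-1 * ·) = expMeasure (-c)⁻¹ := by
      have : IsProbabilityMeasure (F.map (-1 * ·)) :=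
        Measure.isProbabilityMeasure_map (by fun_prop)
      refine Measure.ext_of_charFun (funext fun s => ?_)
      rw [charFun_map_mul, charFun_expMeasure hr, hc]
      simp
    have hlt : ∀ᵐ t ∂F, 0 < -1 * t :=
      ae_of_ae_map (by fun_prop) (hmap ▸ ae_pos_expMeasure _)
    obtain ⟨t, ht, ht'⟩ := (hF.and hlt).exists
    linarith
  · refine .inr (Measure.ext_of_charFun (funext fun s => ?_))
    rw [hc, charFun_dirac]
    simp
  · have hr : 0 < c⁻¹ := inv_pos.mpr hpos
    have := isProbabilityMeasure_expMeasure hr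
    refine .inl ⟨c⁻¹, hr, Measure.ext_of_charFun (funext fun s => ?_)⟩
    rw [charFun_expMeasure hr, hc, inv_inv]

end Exponential

theorem ConditioningIdentityForAll.eq_expMeasure_or_dirac.{u} {F : Measure ℝ}
    [IsProbabilityMeasure F] (hF : ∀ᵐ t ∂F, 0 ≤ t) (h : ConditioningIdentityForAll.{u} F) :
    (∃ r : ℝ, 0 < r ∧ F = expMeasure r) ∨ F = Measure.dirac 0 :=
  have ⟨_, hc⟩ := (h.satisfiesCubicRelation hF).exists_charFun_eq
  eq_expMeasure_or_dirac_of_charFun hF hc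

section RandomSampling

variable {α Ω E : Type*} [MeasurableSpace α] [MeasurableSpace Ω] [NormedAddCommGroup E]
  [MeasurableSpace E] [BorelSpace E] {F : Measure α} {P : Measure Ω}

theorem integrable_uncurry_of_identDistrib [SecondCountableTopology E] [IsFiniteMeasure F]
    [SFinite P] {X : α → Ω → E} (hX : Measurable (Function.uncurry X)) {Z : Ω → E}
    (hXZ : ∀ a, IdentDistrib (X a) Z P P) (hZ : Integrable Z P) :
    Integrable (Function.uncurry X) (F.prod P) := by
  rw [integrable_prod_iff hX.aestronglyMeasurable]
  refine ⟨.of_forall fun a => (hXZ a).integrable_iff.mpr hZ, ?_⟩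
  have hnorm : ∀ a, ∫ ω, ‖X a ω‖ ∂P = ∫ ω, ‖Z ω‖ ∂P := fun a =>
    ((hXZ a).comp measurable_norm).integral_eq
  simp only [Function.uncurry_apply_pair, hnorm]
  exact integrable_const _

variable [NormedSpace ℝ E] [CompleteSpace E] [IsProbabilityMeasure F]

theorem ae_tendsto_sampleMean {f : α → E} (hf : Measurable f) (hint : Integrable f F) :
    ∀ᵐ u ∂Measure.infinitePi fun _ : ℕ => F, Tendsto
      (fun n : ℕ => (n : ℝ)⁻¹ • ∑ i ∈ Finset.range n, f (u i)) atTop (𝓝 (∫ t, f t ∂F)) := by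
  have heval : ∀ i, IdentDistrib (Function.eval i) id (Measure.infinitePi fun _ : ℕ => F) F :=
    fun i => ⟨(measurable_pi_apply i).aemeasurable, aemeasurable_id, by
      rw [Measure.infinitePi_map_eval, Measure.map_id]⟩
  have hident : ∀ i, IdentDistrib (fun u : ℕ → α => f (u i)) f
      (Measure.infinitePi fun _ : ℕ => F) F := fun i => (heval i).comp hf
  have hindep := iIndepFun_infinitePi (P := fun _ : ℕ => F) (X := fun _ => f) fun _ => hf
  have hlaw := strong_law_ae (fun (i : ℕ) (u : ℕ → α) => f (u i))
    ((hident 0).integrable_iff.mpr hint) (fun i j hij => hindep.indepFun hij)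
    fun i => (hident i).trans (hident 0).symm
  rwa [(hident 0).integral_eq] at hlaw

theorem ae_ae_tendsto_sampleMean [SecondCountableTopology E] [IsProbabilityMeasure P]
    {X : α → Ω → E} (hX : Measurable (Function.uncurry X))
    (hint : Integrable (Function.uncurry X) (F.prod P)) :
    ∀ᵐ u ∂Measure.infinitePi fun _ : ℕ => F, ∀ᵐ ω ∂P, Tendsto
      (fun n : ℕ => (n : ℝ)⁻¹ • ∑ i ∈ Finset.range n, X (u i) ω) atTop
      (𝓝 (∫ t, X t ω ∂F)) := by
  have hterm : ∀ i : ℕ, Measurable fun p : (ℕ → α) × Ω => X (p.1 i) p.2 := fun i =>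
    hX.comp (f := fun p : (ℕ → α) × Ω => (p.1 i, p.2)) (by fun_prop)
  have hlim : Measurable fun p : (ℕ → α) × Ω => ∫ t, X t p.2 ∂F :=
    (StronglyMeasurable.integral_prod_right (f := fun ω t => X t ω)
      (hX.comp measurable_swap).stronglyMeasurable).measurable.comp measurable_snd
  rw [Measure.ae_ae_comm]
  · filter_upwards [hint.prod_left_ae] with ω hω
    exact ae_tendsto_sampleMean hX.of_uncurry_right hω
  · exact measurableSet_tendsto_fun (f := fun (n : ℕ) (p : (ℕ → α) × Ω) =>
      (n : ℝ)⁻¹ • ∑ i ∈ Finset.range n, X (p.1 i) p.2)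
      (fun n => (Finset.measurable_fun_sum _ fun i _ => hterm i).const_smul _) hlim

end RandomSampling

theorem identDistrib_of_ae_tendsto {Ω E : Type*} [MeasurableSpace Ω] {P : Measure Ω}
    [IsProbabilityMeasure P] [TopologicalSpace E] [MeasurableSpace E] [BorelSpace E]
    [HasOuterApproxClosed E] {X X' : ℕ → Ω → E} {Z Z' : Ω → E}
    (hXX' : ∀ n, IdentDistrib (X n) (X' n) P P) (hZ : AEMeasurable Z P) (hZ' : AEMeasurable Z' P)
    (hXZ : ∀ᵐ ω ∂P, Tendsto (X · ω) atTop (𝓝 (Z ω)))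
    (hXZ' : ∀ᵐ ω ∂P, Tendsto (X' · ω) atTop (𝓝 (Z' ω))) : IdentDistrib Z Z' P P where
  aemeasurable_fst := hZ
  aemeasurable_snd := hZ'
  map_eq := by
    have h := tendstoInDistribution_of_ae_tendsto (fun n => (hXX' n).aemeasurable_fst) hZ hXZ
    have h' := tendstoInDistribution_of_ae_tendsto (fun n => (hXX' n).aemeasurable_snd) hZ' hXZ'
    refine tendstoInDistribution_unique X h ⟨h.forall_aemeasurable, hZ', ?_⟩
    exact h'.tendsto.congr fun n => Subtype.ext (hXX' n).map_eq.symm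

/-- The moving average `∫ y (t + s) dF(t)` of a path `y`, as a function of the shift `s`; for the
paths of a process it is the weighted average of the process shifted by `s`. -/
noncomputable def movingAverage (F : Measure ℝ) (y : ℝ → ℝ) (s : ℝ) : ℝ := ∫ t, y (t + s) ∂F

theorem measurable_movingAverage {Ω : Type*} [MeasurableSpace Ω] {F : Measure ℝ} [SFinite F]
    {Y : ℝ → Ω → ℝ} (hY : Measurable (Function.uncurry Y)) :
    Measurable fun p : ℝ × Ω => movingAverage F (Y · p.2) p.1 := by
  have hshift : Measurable fun p : (ℝ × Ω) × ℝ => (p.2 + p.1.1, p.1.2) := by fun_prop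
  exact (hY.comp hshift).stronglyMeasurable.integral_prod_right'.measurable

namespace IsStationaryProcess

variable {Ω : Type*} [MeasurableSpace Ω] {P : Measure Ω} {Y : ℝ → Ω → ℝ}

theorem identDistrib_pi (hst : IsStationaryProcess Y P) (hY : ∀ t, Measurable (Y t)) {n : ℕ}
    (t : Fin n → ℝ) (s : ℝ) :
    IdentDistrib (fun ω i => Y (t i + s) ω) (fun ω i => Y (t i) ω) P P where
  aemeasurable_fst := (measurable_pi_lambda _ fun _ => hY _).aemeasurable
  aemeasurable_snd := (measurable_pi_lambda _ fun _ => hY _).aemeasurable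
  map_eq := hst s n t

theorem identDistrib (hst : IsStationaryProcess Y P) (hY : ∀ t, Measurable (Y t)) (s : ℝ) :
    IdentDistrib (Y s) (Y 0) P P := by
  simpa only [zero_add, Function.comp_def] using
    (hst.identDistrib_pi hY (fun _ : Fin 1 => 0) s).comp (measurable_pi_apply 0)

theorem identDistrib_sampleMean_prodMk (hst : IsStationaryProcess Y P)
    (hY : ∀ t, Measurable (Y t)) (u : ℕ → ℝ) (n : ℕ) (s : ℝ) :
    IdentDistrib (fun ω => ((n : ℝ)⁻¹ • ∑ i ∈ Finset.range n, Y (u i + s) ω, Y s ω))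
      (fun ω => ((n : ℝ)⁻¹ • ∑ i ∈ Finset.range n, Y (u i) ω, Y 0 ω)) P P := by
  have hmean : Measurable fun x : Fin (n + 1) → ℝ =>
      ((n : ℝ)⁻¹ • ∑ i : Fin n, x i.succ, x 0) := by fun_prop
  simpa only [Function.comp_def, Fin.cons_succ, Fin.cons_zero, zero_add,
    ← Fin.sum_univ_eq_sum_range (fun i => Y (u i + s) _),
    ← Fin.sum_univ_eq_sum_range (fun i => Y (u i) _)] using
    (hst.identDistrib_pi hY (Fin.cons 0 fun i : Fin n => u i) s).comp hmean

variable [IsProbabilityMeasure P] {F : Measure ℝ} [IsProbabilityMeasure F]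

theorem integrable_shift (hst : IsStationaryProcess Y P) (hY : Measurable (Function.uncurry Y))
    (hint : Integrable (Y 0) P) (s : ℝ) :
    Integrable (Function.uncurry fun t => Y (t + s)) (F.prod P) :=
  integrable_uncurry_of_identDistrib
    (hY.comp ((measurable_fst.add_const s).prodMk measurable_snd))
    (fun t => hst.identDistrib (fun _ => hY.of_uncurry_left) (t + s)) hint

theorem integrable_movingAverage (hst : IsStationaryProcess Y P)
    (hY : Measurable (Function.uncurry Y)) (hint : Integrable (Y 0) P) (s : ℝ) :
    Integrable (fun ω => movingAverage F (Y · ω) s) P :=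
  (hst.integrable_shift hY hint s).integral_prod_right

theorem identDistrib_movingAverage_prodMk (hst : IsStationaryProcess Y P)
    (hY : Measurable (Function.uncurry Y)) (hint : Integrable (Y 0) P) (s : ℝ) :
    IdentDistrib (fun ω => (movingAverage F (Y · ω) s, Y s ω))
      (fun ω => (movingAverage F (Y · ω) 0, Y 0 ω)) P P := by
  have hYt : ∀ t, Measurable (Y t) := fun t => hY.of_uncurry_left
  have hpair : ∀ s, Measurable fun ω => (movingAverage F (Y · ω) s, Y s ω) := fun s =>
    ((measurable_movingAverage hY).comp measurable_prodMk_left).prodMk (hYt s)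
  have hmean : ∀ s, ∀ᵐ u ∂Measure.infinitePi fun _ : ℕ => F, ∀ᵐ ω ∂P, Tendsto
      (fun n : ℕ => ((n : ℝ)⁻¹ • ∑ i ∈ Finset.range n, Y (u i + s) ω, Y s ω)) atTop
      (𝓝 (movingAverage F (Y · ω) s, Y s ω)) := fun s => by
    filter_upwards [ae_ae_tendsto_sampleMean (X := fun t => Y (t + s))
      (hY.comp ((measurable_fst.add_const s).prodMk measurable_snd))
      (hst.integrable_shift hY hint s)] with u hu
    filter_upwards [hu] with ω hω
    exact hω.prodMk_nhds tendsto_const_nhds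
  obtain ⟨u, hus, hu0⟩ := ((hmean s).and (hmean 0)).exists
  simp only [add_zero] at hu0
  exact identDistrib_of_ae_tendsto (fun n => hst.identDistrib_sampleMean_prodMk hYt u n s)
    (hpair s).aemeasurable (hpair 0).aemeasurable hus hu0

end IsStationaryProcess

section LipschitzComposition

variable {E : Type*} [NormedAddCommGroup E]

theorem integrable_comp_of_lipschitzWith {α E' : Type*} [MeasurableSpace α] {μ : Measure α}
    [IsFiniteMeasure μ] [NormedAddCommGroup E'] {φ : E → E'} {K : ℝ≥0} (hφ : LipschitzWith K φ)
    {Z : α → E} (hZ : Integrable Z μ) : Integrable (fun x => φ (Z x)) μ := by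
  have hsub : LipschitzWith K fun x => φ x - φ 0 := by
    simpa only [add_zero] using hφ.sub (LipschitzWith.const (φ 0))
  have hint : Integrable (fun x => φ (Z x) - φ 0) μ :=
    memLp_one_iff_integrable.mp (hsub.comp_memLp (sub_self _) (memLp_one_iff_integrable.mpr hZ))
  exact (hint.add (integrable_const (φ 0))).congr (.of_forall fun _ => sub_add_cancel _ _)

theorem exists_lipschitzWith_hasDerivAt [NormedSpace ℝ E] [CompleteSpace E] {g : ℝ → E}
    (hg : Continuous g) {C : ℝ≥0} (hC : ∀ x, ‖g x‖ ≤ C) :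
    ∃ φ : ℝ → E, LipschitzWith C φ ∧ ∀ x, HasDerivAt φ (g x) x := by
  have hderiv : ∀ x, HasDerivAt (fun x => ∫ t in (0 : ℝ)..x, g t) (g x) x := fun x =>
    intervalIntegral.integral_hasDerivAt_right (hg.intervalIntegrable _ _)
      (hg.stronglyMeasurableAtFilter _ _) hg.continuousAt
  refine ⟨_, lipschitzWith_of_nnnorm_deriv_le (fun x => (hderiv x).differentiableAt) fun x => ?_,
    hderiv⟩
  rw [(hderiv x).deriv]
  exact hC x

theorem absolutelyContinuousOnInterval_of_dist_le_mul {X X' : Type*} [PseudoMetricSpace X]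
    [PseudoMetricSpace X'] {f : ℝ → X} {g : ℝ → X'} {a b : ℝ} {K : ℝ≥0}
    (hf : AbsolutelyContinuousOnInterval f a b)
    (hfg : ∀ x ∈ Set.uIcc a b, ∀ y ∈ Set.uIcc a b, dist (g x) (g y) ≤ K * dist (f x) (f y)) :
    AbsolutelyContinuousOnInterval g a b := by
  rw [absolutelyContinuousOnInterval_iff] at hf ⊢
  intro ε hε
  obtain ⟨δ, hδ, hfδ⟩ := hf (ε / (K + 1)) (by positivity)
  refine ⟨δ, hδ, fun E hE hEδ => ?_⟩
  calc ∑ i ∈ Finset.range E.1, dist (g (E.2 i).1) (g (E.2 i).2)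
      ≤ ∑ i ∈ Finset.range E.1, K * dist (f (E.2 i).1) (f (E.2 i).2) :=
        Finset.sum_le_sum fun i hi => hfg _ (hE.1 i hi).1 _ (hE.1 i hi).2
    _ = K * ∑ i ∈ Finset.range E.1, dist (f (E.2 i).1) (f (E.2 i).2) := (Finset.mul_sum ..).symm
    _ ≤ (K + 1) * ∑ i ∈ Finset.range E.1, dist (f (E.2 i).1) (f (E.2 i).2) := by
        gcongr
        linarith
    _ < ε := (lt_div_iff₀' (by positivity)).mp (hfδ E hE hEδ)

end LipschitzComposition

section ExponentialAverage

variable {r : ℝ} {y : ℝ → ℝ} {s : ℝ}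

theorem movingAverage_expMeasure (hr : 0 < r) (y : ℝ → ℝ) (s : ℝ) :
    movingAverage (expMeasure r) y s =
      Real.exp (r * s) * ∫ u in Set.Ioi s, r * Real.exp (-(r * u)) * y u := by
  have hshift := (measurePreserving_add_right volume s).setIntegral_preimage_emb
    (measurableEmbedding_addRight s) (fun u => r * Real.exp (-(r * u)) * y u) (Set.Ioi s)
  rw [Set.preimage_add_const_Ioi, sub_self] at hshift
  rw [movingAverage, integral_expMeasure hr, ← hshift, ← integral_const_mul]
  refine integral_congr_ae (.of_forall fun x => ?_)
  have hexp : Real.exp (r * s) * Real.exp (-(r * (x + s))) = Real.exp (-(r * x)) := by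
    rw [← Real.exp_add]
    ring_nf
  simp only [smul_eq_mul]
  linear_combination -(r * y (x + s)) * hexp

theorem movingAverage_expMeasure_of_nonneg (hr : 0 < r) (hy : Integrable y (expMeasure r))
    (hs : 0 ≤ s) : movingAverage (expMeasure r) y s = Real.exp (r * s) *
      (movingAverage (expMeasure r) y 0 - ∫ u in (0 : ℝ)..s, r * Real.exp (-(r * u)) * y u) := by
  have hq := (integrable_expMeasure_iff hr y).mp hy
  simp only [smul_eq_mul] at hq
  rw [movingAverage_expMeasure hr, movingAverage_expMeasure hr, mul_zero, Real.exp_zero, one_mul,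
    ← intervalIntegral.integral_Ioi_sub_Ioi hq hs, sub_sub_cancel]

theorem intervalIntegrable_of_integrable_expMeasure (hr : 0 < r)
    (hy : Integrable y (expMeasure r)) (hs : 0 ≤ s) :
    IntervalIntegrable (fun u => r * Real.exp (-(r * u)) * y u) volume 0 s :=
  (intervalIntegrable_iff_integrableOn_Ioc_of_le hs).mpr
    (((integrable_expMeasure_iff hr y).mp hy).mono_set Set.Ioc_subset_Ioi_self)

theorem absolutelyContinuousOnInterval_movingAverage_expMeasure (hr : 0 < r)
    (hy : Integrable y (expMeasure r)) (hs : 0 ≤ s) :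
    AbsolutelyContinuousOnInterval (movingAverage (expMeasure r) y) 0 s := by
  have hexp : ContDiffOn ℝ 1 (fun x => Real.exp (r * x)) (Set.uIcc 0 s) := by fun_prop
  have hconst : ContDiffOn ℝ 1 (fun _ => movingAverage (expMeasure r) y 0) (Set.uIcc 0 s) :=
    contDiffOn_const
  have hprod := hexp.absolutelyContinuousOnInterval.mul
    (hconst.absolutelyContinuousOnInterval.sub
      ((intervalIntegrable_of_integrable_expMeasure hr hy hs)
        |>.absolutelyContinuousOnInterval_intervalIntegral Set.left_mem_uIcc))
  have heq : ∀ x ∈ Set.uIcc 0 s, movingAverage (expMeasure r) y x = _ := fun x hx =>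
    movingAverage_expMeasure_of_nonneg hr hy (Set.uIcc_of_le hs ▸ hx).1
  refine absolutelyContinuousOnInterval_of_dist_le_mul (K := 1) hprod fun x hx z hz => ?_
  rw [heq x hx, heq z hz, NNReal.coe_one, one_mul]
  rfl

theorem ae_hasDerivAt_movingAverage_expMeasure (hr : 0 < r) (hy : Integrable y (expMeasure r)) :
    ∀ᵐ s, 0 < s → HasDerivAt (movingAverage (expMeasure r) y)
      (r * (movingAverage (expMeasure r) y s - y s)) s := by
  have hderiv := fun n : ℕ =>
    (intervalIntegrable_of_integrable_expMeasure hr hy n.cast_nonneg).ae_hasDerivAt_integral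
  filter_upwards [ae_all_iff.mpr hderiv] with s hderiv hs
  obtain ⟨n, hn⟩ := exists_nat_ge s
  have hint := hderiv n (Set.mem_uIcc_of_le hs.le hn) 0 Set.left_mem_uIcc
  have hexp : HasDerivAt (fun x => Real.exp (r * x)) (Real.exp (r * s) * (r * 1)) s :=
    ((hasDerivAt_id s).const_mul r).exp
  refine ((hexp.mul (hint.const_sub (movingAverage (expMeasure r) y 0))).congr_of_eventuallyEq
    ?_).congr_deriv ?_
  · filter_upwards [Ioi_mem_nhds hs] with x hx
    exact movingAverage_expMeasure_of_nonneg hr hy (Set.mem_Ioi.mp hx).le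
  · rw [movingAverage_expMeasure_of_nonneg hr hy hs.le, Real.exp_neg]
    field_simp
    ring

theorem integral_deriv_movingAverage_expMeasure (hr : 0 < r) (hy : Integrable y (expMeasure r))
    (hs : 0 ≤ s) {φ g : ℝ → ℝ} {K : ℝ≥0} (hφ : LipschitzWith K φ)
    (hφg : ∀ x, HasDerivAt φ (g x) x) :
    ∫ x in (0 : ℝ)..s, g (movingAverage (expMeasure r) y x) *
        (r * (movingAverage (expMeasure r) y x - y x)) =
      φ (movingAverage (expMeasure r) y s) - φ (movingAverage (expMeasure r) y 0) := by
  have hac := absolutelyContinuousOnInterval_of_dist_le_mul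
    (g := φ ∘ movingAverage (expMeasure r) y)
    (absolutelyContinuousOnInterval_movingAverage_expMeasure hr hy hs)
    fun _ _ _ _ => hφ.dist_le_mul _ _
  refine (intervalIntegral.integral_congr_ae ?_).trans hac.integral_deriv_eq_sub
  filter_upwards [ae_hasDerivAt_movingAverage_expMeasure hr hy] with x hderiv hx
  rw [Set.uIoc_of_le hs] at hx
  exact ((hφg _).comp x (hderiv hx.1)).deriv.symm

end ExponentialAverage

section ExponentialSufficiency

variable {Ω : Type*} [MeasurableSpace Ω] {P : Measure Ω} [IsProbabilityMeasure P]
  {Y : ℝ → Ω → ℝ}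

theorem IsStationaryProcess.integral_integral_movingAverage {F : Measure ℝ}
    [IsProbabilityMeasure F] (hst : IsStationaryProcess Y P)
    (hY : Measurable (Function.uncurry Y)) (hint : Integrable (Y 0) P) {H : ℝ × ℝ → ℝ}
    (hH : Measurable H)
    (hH0 : Integrable (fun ω => H (movingAverage F (Y · ω) 0, Y 0 ω)) P) :
    ∫ ω, (∫ s in (0 : ℝ)..1, H (movingAverage F (Y · ω) s, Y s ω)) ∂P =
      ∫ ω, H (movingAverage F (Y · ω) 0, Y 0 ω) ∂P := by
  have hlaw := fun s => (hst.identDistrib_movingAverage_prodMk (F := F) hY hint s).comp hH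
  have hjoint : Integrable (Function.uncurry fun s ω => H (movingAverage F (Y · ω) s, Y s ω))
      ((volume.restrict (Set.Ioc 0 1)).prod P) :=
    integrable_uncurry_of_identDistrib (hH.comp ((measurable_movingAverage hY).prodMk hY))
      hlaw hH0
  simp only [intervalIntegral.integral_of_le zero_le_one]
  rw [← integral_integral_swap hjoint]
  have hconst := fun s => (hlaw s).integral_eq
  simp only [Function.comp_apply] at hconst
  simp [hconst]

variable {r : ℝ}

theorem IsStationaryProcess.integral_comp_movingAverage_mul_sub (hst : IsStationaryProcess Y P)
    (hY : Measurable (Function.uncurry Y)) (hint : Integrable (Y 0) P) (hr : 0 < r)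
    {g : ℝ → ℝ} (hg : Continuous g) (hgs : HasCompactSupport g) :
    ∫ ω, g (movingAverage (expMeasure r) (Y · ω) 0) *
      (movingAverage (expMeasure r) (Y · ω) 0 - Y 0 ω) ∂P = 0 := by
  have := isProbabilityMeasure_expMeasure hr
  obtain ⟨C, hC⟩ := hg.bounded_above_of_compact_support hgs
  obtain ⟨φ, hφ, hφg⟩ := exists_lipschitzWith_hasDerivAt hg (C := C.toNNReal)
    fun x => (hC x).trans (Real.le_coe_toNNReal C)
  set Z : ℝ → Ω → ℝ := fun s ω => movingAverage (expMeasure r) (Y · ω) s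
  have hZ : ∀ s, Integrable (Z s) P := hst.integrable_movingAverage hY hint
  have hdrift : Integrable (fun ω => g (Z 0 ω) * (r * (Z 0 ω - Y 0 ω))) P :=
    (((hZ 0).sub hint).const_mul r).bdd_mul (hg.comp_aestronglyMeasurable (hZ 0).1)
      (.of_forall fun ω => hC _)
  have hpath : ∀ᵐ ω ∂P, ∫ s in (0 : ℝ)..1, g (Z s ω) * (r * (Z s ω - Y s ω)) =
      φ (Z 1 ω) - φ (Z 0 ω) := by
    filter_upwards [(hst.integrable_shift (F := expMeasure r) hY hint 0).prod_left_ae] with ω hω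
    simp only [Function.uncurry_apply_pair, add_zero] at hω
    exact integral_deriv_movingAverage_expMeasure hr hω zero_le_one hφ hφg
  have hlaw : ∫ ω, φ (Z 1 ω) ∂P = ∫ ω, φ (Z 0 ω) ∂P :=
    ((hst.identDistrib_movingAverage_prodMk hY hint 1).comp
      (hφ.continuous.measurable.comp measurable_fst)).integral_eq
  have hzero : r * ∫ ω, g (Z 0 ω) * (Z 0 ω - Y 0 ω) ∂P = 0 :=
    calc r * ∫ ω, g (Z 0 ω) * (Z 0 ω - Y 0 ω) ∂P
        = ∫ ω, g (Z 0 ω) * (r * (Z 0 ω - Y 0 ω)) ∂P := by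
          simp only [← integral_const_mul, mul_left_comm r]
      _ = ∫ ω, (∫ s in (0 : ℝ)..1, g (Z s ω) * (r * (Z s ω - Y s ω))) ∂P :=
          (hst.integral_integral_movingAverage (F := expMeasure r) hY hint
            (H := fun p => g p.1 * (r * (p.1 - p.2))) (by fun_prop) hdrift).symm
      _ = ∫ ω, (φ (Z 1 ω) - φ (Z 0 ω)) ∂P := integral_congr_ae hpath
      _ = 0 := by
          rw [integral_sub (integrable_comp_of_lipschitzWith hφ (hZ 1))
            (integrable_comp_of_lipschitzWith hφ (hZ 0)), hlaw, sub_self]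
  exact (mul_eq_zero.mp hzero).resolve_left hr.ne'

theorem IsStationaryProcess.conditioningIdentity_expMeasure (hst : IsStationaryProcess Y P)
    (hY : Measurable (Function.uncurry Y)) (hint : Integrable (Y 0) P) (hr : 0 < r) :
    ConditioningIdentity (expMeasure r) Y P := by
  have := isProbabilityMeasure_expMeasure hr
  have havg : weightedAverage (expMeasure r) Y =
      fun ω => movingAverage (expMeasure r) (Y · ω) 0 := by
    simp only [weightedAverage_eq_integral ((ae_pos_expMeasure r).mono fun _ => le_of_lt),
      movingAverage, add_zero]
  have hle := comap_weightedAverage_le (expMeasure r) Y hY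
  have hmeas : Measurable (weightedAverage (expMeasure r) Y) := .of_comap_le hle
  have hZ : Integrable (weightedAverage (expMeasure r) Y) P :=
    havg ▸ hst.integrable_movingAverage hY hint 0
  have hdiff := condExp_comap_ae_eq_zero hmeas (hZ.sub hint) fun g hg hgs => by
    simpa only [havg, Pi.sub_apply] using hst.integral_comp_movingAverage_mul_sub hY hint hr hg hgs
  rw [ConditioningIdentity]
  filter_upwards [hdiff, condExp_sub hZ hint _] with ω hω hsub
  rw [hsub, Pi.sub_apply, condExp_of_stronglyMeasurable hle
    (comap_measurable _).stronglyMeasurable hZ, Pi.zero_apply, sub_eq_zero] at hω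
  exact hω.symm

end ExponentialSufficiency

theorem conditioningIdentity_dirac_zero {Ω : Type*} [MeasurableSpace Ω] {P : Measure Ω}
    [IsFiniteMeasure P] {Y : ℝ → Ω → ℝ} (hY : Measurable (Function.uncurry Y))
    (hint : Integrable (Y 0) P) : ConditioningIdentity (Measure.dirac 0) Y P := by
  have havg : weightedAverage (Measure.dirac 0) Y = Y 0 := by
    simp only [weightedAverage_eq_integral (F := Measure.dirac 0) (by simp), integral_dirac]
  have hle := comap_weightedAverage_le (Measure.dirac 0) Y hY
  rw [ConditioningIdentity]
  rw [havg] at hle ⊢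
  rw [condExp_of_stronglyMeasurable hle (comap_measurable _).stronglyMeasurable hint]

theorem proposition3p3_general.{u} {F : Measure ℝ} [IsProbabilityMeasure F]
    (hF : F (Set.Iio 0) = 0) :
    ConditioningIdentityForAll.{u} F ↔
      ((∃ r : ℝ, 0 < r ∧ F = expMeasure r) ∨ F = Measure.dirac 0) := by
  have hF0 : ∀ᵐ t ∂F, 0 ≤ t := by
    simpa only [Set.mem_Iio, not_lt] using measure_eq_zero_iff_ae_notMem.mp hF
  refine ⟨fun h => h.eq_expMeasure_or_dirac hF0, ?_⟩
  rintro (⟨r, hr, rfl⟩ | rfl) Ω _ P _ Y hY hst hint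
  · exact hst.conditioningIdentity_expMeasure hY hint hr
  · exact conditioningIdentity_dirac_zero hY hint

theorem proposition3p3 (F : Measure ℝ) [IsProbabilityMeasure F]
    (hF : F (Set.Iio 0) = 0)
    (hF' : HasLebesgueDensity F ∨ IsLatticeDistribution F) :
    (∀ (Ω : Type*) [MeasurableSpace Ω] (P : Measure Ω) [IsProbabilityMeasure P]
        (Y : ℝ → Ω → ℝ),
        Measurable (Function.uncurry Y) → IsStationaryProcess Y P → Integrable (Y 0) P →
        ConditioningIdentity F Y P) ↔
      ((∃ r : ℝ, 0 < r ∧ F = expMeasure r) ∨ F = Measure.dirac 0) :=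
  proposition3p3_general hF
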